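/- Theorem 1.3. For integers $d,L,n\ge 0$, a set $\mathcal C\subseteq\{0,1\}^n$ is a $(d,L,n)$-code if for every $w\in\mathcal C$ and every set $S$ of exactly $d$ of the $n$ coordinates, at most $L$ words of $\mathcal C$ agree with $w$ in all coordinates outside $S$. Let $L(d)$ be the smallest $L$ for which there is an $\varepsilon=\varepsilon(d)>0$ such that for every $n$ there is a $(d,L,n)$-code of cardinality at least $\varepsilon 2^n$. Then $$L(5)=8,\qquad L(6)\le 16,\qquad L(7)\le 28.$$ Moreover, the limit $$c=\lim_{t\to\infty}\frac{\prod_{i=1}^{t-1}(2^t-2^i)}{(2^t-1)^{t-1}}$$ exists, it is $0.29$ to two decimal places ($|c-0.29|<0.005$), and for large $d$ $$L(d)\le (c+o(1))\binom{d}{\lfloor d/2\rfloor},$$ where the $o(1)$ term tends to $0$ as $d\to\infty$. -/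

import Mathlib

open Filter Topology

/-- `C` is a `(d, L)`-list decodable erasure code of length `n`: for every codeword `w`, after
erasing any `d` bits of `w` (those in the coordinate set `S`), the remaining part of `w` has at
most `L` completions into codewords of `C`. -/
def IsErasureCode (d L n : ℕ) (C : Finset (Fin n → Bool)) : Prop :=
  ∀ w ∈ C, ∀ S : Finset (Fin n), S.card = d →
    (C.filter (fun x => ∀ i, i ∉ S → x i = w i)).card ≤ L

/-- `L` is admissible for `d` if for some `ε > 0` there is, for every length `n`, a
`(d, L, n)`-code with at least `ε * 2 ^ n` codewords. -/
def HasDenseErasureCodes (d L : ℕ) : Prop :=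
  ∃ ε : ℝ, 0 < ε ∧ ∀ n : ℕ, ∃ C : Finset (Fin n → Bool),
    IsErasureCode d L n C ∧ ε * 2 ^ n ≤ (C.card : ℝ)

/-- `L(d)`: the smallest admissible list size for `d` erasures
(see `erasureListSize_isLeast`: the minimum exists). -/
noncomputable def erasureListSize (d : ℕ) : ℕ :=
  sInf {L : ℕ | HasDenseErasureCodes d L}

/-- The list size `2 ^ d` is always admissible, by the full cube. -/
theorem hasDenseErasureCodes_two_pow (d : ℕ) : HasDenseErasureCodes d (2 ^ d) := by
  refine ⟨1, one_pos, fun n => ⟨Finset.univ, ?_, by simp⟩⟩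
  intro w _ S hS
  calc _ ≤ (Finset.univ : Finset (S → Bool)).card := by
        refine Finset.card_le_card_of_injOn (fun x i => x i.1) (fun _ _ => by simp) ?_
        intro x hx y hy hxy
        have hx' := (Finset.mem_filter.mp hx).2
        have hy' := (Finset.mem_filter.mp hy).2
        funext i
        by_cases hi : i ∈ S
        · exact congrFun hxy ⟨i, hi⟩
        · rw [hx' i hi, hy' i hi]
    _ = 2 ^ d := by simp [hS]

theorem erasureListSize_isLeast (d : ℕ) :
    IsLeast {L : ℕ | HasDenseErasureCodes d L} (erasureListSize d) :=
  ⟨Nat.sInf_mem ⟨2 ^ d, hasDenseErasureCodes_two_pow d⟩, fun _ h => Nat.sInf_le h⟩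

/-- `P(t) = (2^t - 2)(2^t - 4) ⋯ (2^t - 2^(t-1)) / (2^t - 1)^(t-1)`. -/
noncomputable def basisRatio (t : ℕ) : ℝ :=
  (∏ i ∈ Finset.Icc 1 (t - 1), ((2 : ℝ) ^ t - 2 ^ i)) / ((2 : ℝ) ^ t - 1) ^ (t - 1)

/-! Upper bounds. View words as subsets of the coordinates. For each `r` pick `n` vectors in `𝔽₂^r`,
and keep the sets `W` whose vectors in `𝔽₂^|W|` form a basis, with `|W|` in one residue class mod `d
+ 1`. A random `r`-set is a basis with probability at least 1/4, so a positive density survives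
(`exists_card_independentFamily_ge`). Members `W`, `X` agreeing outside a `d`-set `S` have equal
size, and modulo the span of `W \ S` the part `X ∩ S` is a basis. Hence lists are no longer than the
largest number of bases of `𝔽₂^k`, `k ≤ d`, among `d` vectors (`card_filter_independentFamily_le`).

Bases are counted by contracting one vector at a time. Spreading the vectors evenly over the nonzero
ones is extremal for the resulting estimate, which yields `basisRatio k * d ^ k / k!`
(`factorial_mul_indepCount_le`). Double counting carries a bound from `(d, k)` to `(d + 1, k + 1)`
without loss relative to the binomial coefficient. This gives the small cases, and also the
asymptotics, where `c` is the infinite product of `1 - 2^{-j}`.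

Lower bound. In a dense family some `W` has a positive proportion of triples `x, y, z` all of whose
pairs extend `W` to members. Many triangles force a wheel: a hub joined to a four-cycle, eight edges
on five vertices, hence eight members in a five-dimensional subcube (`exists_eight_le_card`). -/

/-! ### Independent sets and contraction. -/

open Classical in
/-- The number of `t`-element subsets of `A` on which `f` is linearly independent over `𝔽₂`. -/
noncomputable def indepCount {ι V : Type*} [AddCommGroup V] [Module (ZMod 2) V]
    (f : ι → V) (A : Finset ι) (t : ℕ) : ℕ :=
  ((A.powersetCard t).filter fun T : Finset ι => LinearIndepOn (ZMod 2) f (T : Set ι)).card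

section IndepCount

variable {ι V : Type*} [AddCommGroup V] [Module (ZMod 2) V]

theorem indepCount_le_choose (f : ι → V) (A : Finset ι) (t : ℕ) :
    indepCount f A t ≤ A.card.choose t := by
  classical
  unfold indepCount
  exact (Finset.card_filter_le _ _).trans (Finset.card_powersetCard t A).le

open Classical in
/-- Choosing an independent set together with one of its elements amounts to choosing the element
and then an independent set in the contraction by it. -/
theorem succ_mul_indepCount_le (f : ι → V) (A : Finset ι) (t : ℕ) :
    (t + 1) * indepCount f A (t + 1) ≤
      ∑ i ∈ A with f i ≠ 0,
        indepCount (Submodule.mkQ (Submodule.span (ZMod 2) (f '' {i})) ∘ f)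
          {j ∈ A | f j ≠ 0 ∧ f j ≠ f i} t := by
  set F := (A.powersetCard (t + 1)).filter fun T : Finset ι => LinearIndepOn (ZMod 2) f (T : Set ι) with hF
  have hmem : ∀ T ∈ F, T ⊆ A ∧ T.card = t + 1 ∧ LinearIndepOn (ZMod 2) f (T : Set ι) := by
    intro T hT
    rw [hF, Finset.mem_filter, Finset.mem_powersetCard] at hT
    exact ⟨hT.1.1, hT.1.2, hT.2⟩
  have h1 : (t + 1) * indepCount f A (t + 1) =
      ∑ T ∈ F, (({i ∈ A | f i ≠ 0} : Finset ι).filter fun i => i ∈ T).card := by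
    rw [Finset.sum_congr rfl (g := fun _ => t + 1), Finset.sum_const, smul_eq_mul, mul_comm]
    · rfl
    · intro T hT
      obtain ⟨hA, hc, hl⟩ := hmem T hT
      rw [← hc]
      congr 1
      ext i
      simp only [Finset.mem_filter]
      exact ⟨fun h => h.2, fun h => ⟨⟨hA h, hl.ne_zero h⟩, h⟩⟩
  have h2 := Finset.sum_card_bipartiteAbove_eq_sum_card_bipartiteBelow
    (s := F) (t := ({i ∈ A | f i ≠ 0} : Finset ι)) (fun T i => i ∈ T)
  simp only [Finset.bipartiteAbove, Finset.bipartiteBelow] at h2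
  rw [h1, h2]
  refine Finset.sum_le_sum fun i _ => ?_
  unfold indepCount
  refine Finset.card_le_card_of_injOn (fun T => T.erase i) ?_ ?_
  · intro T hT
    rw [Finset.mem_coe, Finset.mem_filter] at hT
    obtain ⟨hT, hi⟩ := hT
    obtain ⟨hA, hc, hl⟩ := hmem T hT
    rw [Finset.mem_coe, Finset.mem_filter, Finset.mem_powersetCard]
    refine ⟨⟨fun j hj => ?_, by rw [Finset.card_erase_of_mem hi, hc]; rfl⟩, ?_⟩
    · rw [Finset.mem_erase] at hj
      rw [Finset.mem_filter]
      exact ⟨hA hj.2, hl.ne_zero hj.2, fun h => hj.1 (hl.injOn hj.2 hi h)⟩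
    · have hu : (T : Set ι) = ({i} : Set ι) ∪ ((T.erase i : Finset ι) : Set ι) := by
        ext j
        by_cases h : j = i <;> simp [h, hi]
      rw [hu, linearIndepOn_union_iff_quotient (by simp)] at hl
      exact hl.2
  · intro T hT T' hT' h
    rw [Finset.mem_coe, Finset.mem_filter] at hT hT'
    rw [← Finset.insert_erase hT.2, ← Finset.insert_erase hT'.2]
    exact congrArg (insert i) h

theorem finrank_quotient_span_image_singleton [Finite V] (f : ι → V) {i : ι} (hi : f i ≠ 0) {t : ℕ}
    (ht : Module.finrank (ZMod 2) V = t + 1) :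
    Module.finrank (ZMod 2) (V ⧸ Submodule.span (ZMod 2) (f '' {i})) = t := by
  have h := Submodule.finrank_quotient_add_finrank (Submodule.span (ZMod 2) (f '' {i}))
  rw [Set.image_singleton, finrank_span_singleton hi] at h
  rw [Set.image_singleton]
  omega

end IndepCount

/-! ### Counting bases by induction on the dimension. -/

theorem basisRatio_zero : basisRatio 0 = 1 := by simp [basisRatio]

/-- The new factor is the proportion of vectors surviving contraction, raised to the power `t`, when
they are spread evenly over the `2^(t+1) - 1` nonzero ones. -/
theorem basisRatio_succ (t : ℕ) :
    basisRatio (t + 1) = basisRatio t * (1 - 1 / ((2 : ℝ) ^ (t + 1) - 1)) ^ t := by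
  rcases t with _ | s
  · simp [basisRatio]
  have h1 : (1 : ℝ) < 2 ^ (s + 1) := one_lt_pow₀ one_lt_two (by omega)
  have h2 : (1 : ℝ) < 2 ^ (s + 1 + 1) := one_lt_pow₀ one_lt_two (by omega)
  have h1' : (2 : ℝ) ^ (s + 1) - 1 ≠ 0 := by linarith
  have h2' : (2 : ℝ) ^ (s + 1 + 1) - 1 ≠ 0 := by linarith
  have hp : ∏ i ∈ Finset.Icc 1 (s + 1), ((2 : ℝ) ^ (s + 1 + 1) - 2 ^ i) =
      2 ^ (s + 1) * (2 ^ (s + 1) - 1) * ∏ i ∈ Finset.Icc 1 s, ((2 : ℝ) ^ (s + 1) - 2 ^ i) := by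
    have e : ∀ (m : ℕ) (g : ℕ → ℝ), ∏ i ∈ Finset.Icc 1 m, g i = ∏ i ∈ Finset.range m, g (i + 1) := by
      intro m g
      rw [Finset.range_eq_Ico, Finset.prod_Ico_add' g 0 m 1]
      rfl
    rw [e, e, ← Finset.prod_congr rfl (fun i _ => show 2 * ((2 : ℝ) ^ (s + 1) - 2 ^ i) = _ by ring),
      Finset.prod_mul_distrib, Finset.prod_const, Finset.card_range, Finset.prod_range_succ']
    ring
  have hq : 1 - 1 / ((2 : ℝ) ^ (s + 1 + 1) - 1) =
      2 * (2 ^ (s + 1) - 1) / ((2 : ℝ) ^ (s + 1 + 1) - 1) := by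
    rw [eq_div_iff h2', sub_mul, div_mul_cancel₀ _ h2']
    ring
  rw [hq]
  unfold basisRatio
  simp only [Nat.add_sub_cancel]
  rw [hp, div_pow, mul_pow, div_mul_div_comm, div_eq_div_iff (by positivity) (by positivity)]
  ring

/-- A polynomial inequality expressing the tangent line bound for `x * (1 - x) ^ s`. -/
theorem tangent_poly_nonneg (s : ℕ) {y : ℝ} (hy : 0 ≤ y) :
    0 ≤ (s : ℝ) * y ^ (s + 1) - (s + 1) * y ^ s + 1 := by
  induction s with
  | zero => simp
  | succ s ih =>
    have h : ((s + 1 : ℕ) : ℝ) * y ^ (s + 1 + 1) - ((s + 1 : ℕ) + 1) * y ^ (s + 1) + 1 =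
        y * ((s : ℝ) * y ^ (s + 1) - (s + 1) * y ^ s + 1) + (y - 1) * (y ^ (s + 1) - 1) := by
      push_cast; ring
    have h2 : 0 ≤ (y - 1) * (y ^ (s + 1) - 1) := by
      rcases le_total 1 y with h1 | h1
      · exact mul_nonneg (by linarith) (by linarith [one_le_pow₀ h1 (n := s + 1)])
      · exact mul_nonneg_of_nonpos_of_nonpos (by linarith)
          (by linarith [pow_le_one₀ hy h1 (n := s + 1)])
    rw [h]
    exact add_nonneg (mul_nonneg hy ih) h2

/-- The function need not be concave, but its tangent at `a` still dominates it. In `y = (1 - x) /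
(1 - a)` the gap is a positive factor times an expression affine in `a`, decreasing by Bernoulli.
The worst case `a = 1 / (s + 1)` is `tangent_poly_nonneg`. -/
theorem tangent_le {s : ℕ} {a x : ℝ} (ha1 : a < 1) (hsa : (s + 1) * a ≤ 1)
    (hx : x ≤ 1) :
    x * (1 - x) ^ (s + 1) ≤
      a * (1 - a) ^ (s + 1) + (1 - a) ^ s * (1 - (s + 2) * a) * (x - a) := by
  obtain ⟨y, hy⟩ : ∃ y, y = (1 - x) / (1 - a) := ⟨_, rfl⟩
  have hb : 0 < 1 - a := by linarith
  have hy0 : 0 ≤ y := hy ▸ div_nonneg (by linarith) hb.le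
  have hxy : 1 - x = (1 - a) * y := by rw [hy]; field_simp
  have hx' : x = 1 - (1 - a) * y := by linarith
  have hbern : 0 ≤ y ^ (s + 2) - (s + 2) * y + (s + 1) := by
    have := one_add_mul_le_pow (show (-2 : ℝ) ≤ y - 1 by linarith) (s + 2)
    push_cast at this
    rw [show 1 + (y - 1) = y by ring] at this
    linarith
  have key : 0 ≤ (s + 1) * (y ^ (s + 2) - y ^ (s + 1) - y + 1) -
      (y ^ (s + 2) - (s + 2) * y + (s + 1)) := by
    have := mul_nonneg hy0 (tangent_poly_nonneg s hy0)
    have e : (s + 1) * (y ^ (s + 2) - y ^ (s + 1) - y + 1) -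
      (y ^ (s + 2) - (s + 2) * y + (s + 1)) = y * ((s : ℝ) * y ^ (s + 1) - (s + 1) * y ^ s + 1) := by
      ring
    rw [e]; exact this
  have hs : (0 : ℝ) < s + 1 := by positivity
  have h1 : 0 ≤ (y ^ (s + 2) - y ^ (s + 1) - y + 1) -
      a * (y ^ (s + 2) - (s + 2) * y + (s + 1)) := by
    have h3 : 0 ≤ (s + 1) * ((y ^ (s + 2) - y ^ (s + 1) - y + 1) -
      a * (y ^ (s + 2) - (s + 2) * y + (s + 1))) := by
      nlinarith [mul_nonneg (sub_nonneg.2 hsa) hbern]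
    exact nonneg_of_mul_nonneg_right h3 hs
  have h4 := mul_nonneg (pow_nonneg hb.le (s + 1)) h1
  rw [hxy, hx']
  rw [← sub_nonneg]
  refine h4.trans_eq ?_
  rw [mul_pow]
  ring

/-- Normalise the sum to 1 and add the tangent bounds at the mean `1 / K.card`: the linear terms
cancel. -/
theorem sum_mul_sub_pow_le {κ : Type*} (K : Finset κ) (x : κ → ℝ) (s : ℕ) (hK : s + 1 < K.card)
    (h0 : ∀ k ∈ K, 0 ≤ x k) :
    ∑ k ∈ K, x k * ((∑ l ∈ K, x l) - x k) ^ (s + 1) ≤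
      (∑ k ∈ K, x k) ^ (s + 2) * (1 - 1 / (K.card : ℝ)) ^ (s + 1) := by
  set m := ∑ k ∈ K, x k with hm
  have hle : ∀ k ∈ K, x k ≤ m := fun k hk => Finset.single_le_sum h0 hk
  have hm0 : 0 ≤ m := Finset.sum_nonneg h0
  rcases hm0.eq_or_lt with h | hpos
  · rw [← h]
    have : ∀ k ∈ K, x k * (0 - x k) ^ (s + 1) = 0 := fun k hk => by
      have : x k = 0 := le_antisymm (by rw [h]; exact hle k hk) (h0 k hk)
      simp [this]
    rw [Finset.sum_eq_zero this]
    simp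
  have hN : (0 : ℝ) < K.card := by exact_mod_cast (by omega : 0 < K.card)
  have hN1 : ((s : ℝ) + 1) < K.card := by exact_mod_cast hK
  set a : ℝ := 1 / (K.card : ℝ) with ha
  have hNa : (K.card : ℝ) * a = 1 := by rw [ha]; field_simp
  have ha0 : 0 ≤ a := by positivity
  have ha1 : a < 1 := by
    rw [ha, div_lt_one hN]; linarith [(Nat.cast_nonneg s : (0 : ℝ) ≤ s)]
  have hsa : (s + 1) * a ≤ 1 := by
    exact (mul_le_mul_of_nonneg_right hN1.le ha0).trans_eq hNa
  have hk : ∀ k ∈ K, x k * (m - x k) ^ (s + 1) ≤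
      m ^ (s + 2) * (a * (1 - a) ^ (s + 1) + (1 - a) ^ s * (1 - (s + 2) * a) * (x k / m - a)) := by
    intro k hk
    have := tangent_le (s := s) ha1 hsa (show x k / m ≤ 1 from (div_le_one hpos).2 (hle k hk))
    refine le_trans (le_of_eq ?_) (mul_le_mul_of_nonneg_left this (by positivity : 0 ≤ m ^ (s + 2)))
    have e1 : x k = m * (x k / m) := by field_simp
    have e2 : m - x k = m * (1 - x k / m) := by field_simp
    rw [e2, mul_pow]
    nth_rewrite 1 [e1]
    ring
  refine (Finset.sum_le_sum hk).trans (le_of_eq ?_)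
  rw [← Finset.mul_sum, Finset.sum_add_distrib, Finset.sum_const, ← Finset.mul_sum,
    Finset.sum_sub_distrib, Finset.sum_const, ← Finset.sum_div, ← hm, div_self hpos.ne',
    nsmul_eq_mul, nsmul_eq_mul, hNa, ← mul_assoc, hNa]
  ring

theorem succ_succ_lt_two_pow_sub_one (s : ℕ) : s + 1 < 2 ^ (s + 2) - 1 := by
  have := Nat.lt_two_pow_self (n := s + 2)
  omega

theorem basisRatio_nonneg (t : ℕ) : 0 ≤ basisRatio t := by
  unfold basisRatio
  have h : (1 : ℝ) ≤ 2 ^ t := one_le_pow₀ one_le_two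
  refine div_nonneg (Finset.prod_nonneg fun i hi => ?_) (pow_nonneg (by linarith) _)
  rw [Finset.mem_Icc] at hi
  rw [sub_nonneg]
  exact pow_le_pow_right₀ one_le_two (by omega)

/-- The space is quantified inside the induction because contraction replaces it by a quotient.
Contracting `f i` discards its whole fibre, and `sum_mul_sub_pow_le` optimises over the fibre sizes.
-/
theorem factorial_mul_indepCount_le {ι : Type*} (t : ℕ) : ∀ {V : Type*} [AddCommGroup V]
    [Module (ZMod 2) V] [Finite V] (_ : Module.finrank (ZMod 2) V = t) (f : ι → V) (A : Finset ι),
    (t.factorial : ℝ) * indepCount f A t ≤ basisRatio t * (A.card : ℝ) ^ t := by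
  classical
  induction t with
  | zero =>
    intro V _ _ _ _ f A
    have := indepCount_le_choose f A 0
    rw [Nat.choose_zero_right] at this
    simpa [basisRatio_zero] using this
  | succ t ih =>
    intro V _ _ _ hV f A
    have : Fintype V := Fintype.ofFinite V
    have hcard : Fintype.card V = 2 ^ (t + 1) := by
      rw [Module.card_eq_pow_finrank (K := ZMod 2), hV, ZMod.card]
    set K : Finset V := Finset.univ.erase 0 with hKdef
    have hK : K.card = 2 ^ (t + 1) - 1 := by
      rw [hKdef, Finset.card_erase_of_mem (Finset.mem_univ _), Finset.card_univ, hcard]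
    set A' : Finset ι := {i ∈ A | f i ≠ 0} with hA'
    set x : V → ℝ := fun v => (({i ∈ A' | f i = v} : Finset ι).card : ℝ) with hx
    have hmaps : ∀ i ∈ A', f i ∈ K := fun i hi => by
      simpa [hKdef] using (Finset.mem_filter.1 hi).2
    have hsum : ∑ v ∈ K, x v = A'.card := by
      rw [hx, ← Nat.cast_sum, ← Finset.card_eq_sum_card_fiberwise hmaps]
    have hcontr : ((t + 1).factorial : ℝ) * indepCount f A (t + 1) ≤
        ∑ i ∈ A', basisRatio t * ((A'.card : ℝ) - x (f i)) ^ t := by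
      have h := succ_mul_indepCount_le f A t
      have h' : ((t : ℝ) + 1) * indepCount f A (t + 1) ≤ ∑ i ∈ A',
        (indepCount (Submodule.mkQ (Submodule.span (ZMod 2) (f '' {i})) ∘ f)
          {j ∈ A | f j ≠ 0 ∧ f j ≠ f i} t : ℝ) := by exact_mod_cast h
      rw [Nat.factorial_succ, Nat.cast_mul, mul_comm ((t + 1 : ℕ) : ℝ), mul_assoc]
      push_cast
      refine (mul_le_mul_of_nonneg_left h' (by positivity)).trans ?_
      rw [Finset.mul_sum]
      refine Finset.sum_le_sum fun i hi => ?_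
      have hfi : f i ≠ 0 := (Finset.mem_filter.1 hi).2
      refine (ih (finrank_quotient_span_image_singleton f hfi hV) _ _).trans (le_of_eq ?_)
      congr 2
      have e : ({j ∈ A | f j ≠ 0 ∧ f j ≠ f i} : Finset ι) = {j ∈ A' | ¬ f j = f i} := by
        rw [hA', Finset.filter_filter]
      rw [e, eq_sub_iff_add_eq, add_comm]
      simp only [hx]
      exact_mod_cast Finset.card_filter_add_card_filter_not (s := A') (fun j => f j = f i)
    refine hcontr.trans ?_
    rw [← Finset.mul_sum, basisRatio_succ, mul_assoc]
    refine mul_le_mul_of_nonneg_left ?_ (basisRatio_nonneg t)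
    have hAA : (A'.card : ℝ) ≤ A.card := by exact_mod_cast Finset.card_filter_le _ _
    have hfib : ∑ i ∈ A', ((A'.card : ℝ) - x (f i)) ^ t =
        ∑ v ∈ K, x v * ((∑ v ∈ K, x v) - x v) ^ t := by
      rw [← Finset.sum_fiberwise_of_maps_to hmaps, hsum]
      refine Finset.sum_congr rfl fun v _ => ?_
      rw [Finset.sum_congr rfl (g := fun _ => ((A'.card : ℝ) - x v) ^ t), Finset.sum_const,
        nsmul_eq_mul]
      intro i hi
      rw [(Finset.mem_filter.1 hi).2]
    rw [hfib]
    rcases t with _ | s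
    · simpa [hsum] using hAA
    · have h := sum_mul_sub_pow_le K x s (by rw [hK]; exact succ_succ_lt_two_pow_sub_one s)
        (fun _ _ => Nat.cast_nonneg _)
      have hc : (K.card : ℝ) = 2 ^ (s + 1 + 1) - 1 := by
        rw [hK, Nat.cast_sub Nat.one_le_two_pow]; simp
      rw [hc, hsum] at h
      rw [hsum]
      refine h.trans ?_
      rw [mul_comm]
      have h2 : (2 : ℝ) ≤ 2 ^ (s + 1 + 1) := by
        calc (2 : ℝ) = 2 ^ 1 := by norm_num
          _ ≤ _ := pow_le_pow_right₀ one_le_two (by omega)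
      have h3 : 0 ≤ 1 - 1 / ((2 : ℝ) ^ (s + 1 + 1) - 1) := by
        rw [sub_nonneg, div_le_one (by linarith)]; linarith
      gcongr

/-! ### Propagating bounds, and the cases d = 5, 6, 7. -/

/-- Independent `k`-subsets of at most `d` vectors in a `k`-dimensional space over `𝔽₂` number at
most `B`. -/
def IndepCountBound (d k : ℕ) (B : ℝ) : Prop :=
  ∀ (ι V : Type) [AddCommGroup V] [Module (ZMod 2) V] [Finite V],
    Module.finrank (ZMod 2) V = k → ∀ (f : ι → V) (A : Finset ι), A.card ≤ d →
      (indepCount f A k : ℝ) ≤ B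

theorem IndepCountBound.mono {d k : ℕ} {B B' : ℝ} (h : IndepCountBound d k B) (hB : B ≤ B') :
    IndepCountBound d k B' := fun ι V _ _ _ hV f A hA => (h ι V hV f A hA).trans hB

theorem indepCountBound_choose (d k : ℕ) : IndepCountBound d k (d.choose k : ℝ) := by
  intro ι V _ _ _ _ f A hA
  exact_mod_cast (indepCount_le_choose f A k).trans (Nat.choose_le_choose k hA)

theorem indepCountBound_basisRatio (d k : ℕ) :
    IndepCountBound d k (basisRatio k * (d : ℝ) ^ k / k.factorial) := by
  intro ι V _ _ _ hV f A hA
  rw [le_div_iff₀ (by positivity), mul_comm]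
  refine (factorial_mul_indepCount_le k hV f A).trans ?_
  have := basisRatio_nonneg k
  gcongr

/-- Each vector lies in at most `B` bases, by contraction; count pairs (basis, element). -/
theorem IndepCountBound.succ {d k : ℕ} {B : ℝ} (h : IndepCountBound d k B) (hB : 0 ≤ B) :
    IndepCountBound (d + 1) (k + 1) ((d + 1) * B / (k + 1)) := by
  classical
  intro ι V _ _ _ hV f A hA
  rw [le_div_iff₀ (by positivity), mul_comm]
  have h1 : ((k : ℝ) + 1) * indepCount f A (k + 1) ≤ ∑ i ∈ A with f i ≠ 0,
      (indepCount (Submodule.mkQ (Submodule.span (ZMod 2) (f '' {i})) ∘ f)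
        {j ∈ A | f j ≠ 0 ∧ f j ≠ f i} k : ℝ) := by exact_mod_cast succ_mul_indepCount_le f A k
  refine h1.trans ((Finset.sum_le_card_nsmul _ _ B fun i hi => ?_).trans ?_)
  · rw [Finset.mem_filter] at hi
    have : Finite (V ⧸ Submodule.span (ZMod 2) (f '' {i})) :=
      Finite.of_surjective _ (Submodule.mkQ_surjective _)
    refine h _ _ (finrank_quotient_span_image_singleton f hi.2 hV) _ _ ?_
    have hss : ({j ∈ A | f j ≠ 0 ∧ f j ≠ f i} : Finset ι) ⊆ A.erase i := by
      intro j hj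
      rw [Finset.mem_filter] at hj
      exact Finset.mem_erase.2 ⟨fun e => hj.2.2 (e ▸ rfl), hj.1⟩
    have := Finset.card_le_card hss
    rw [Finset.card_erase_of_mem hi.1] at this
    omega
  · rw [nsmul_eq_mul]
    refine mul_le_mul_of_nonneg_right ?_ hB
    exact_mod_cast (Finset.card_filter_le _ _).trans hA

theorem IndepCountBound.floor {d k : ℕ} {B : ℝ} (h : IndepCountBound d k B) {L : ℕ}
    (hL : B < L + 1) : IndepCountBound d k L := by
  intro ι V _ _ _ hV f A hA
  have : (indepCount f A k : ℝ) < L + 1 := (h ι V hV f A hA).trans_lt hL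
  exact_mod_cast Nat.lt_succ_iff.1 (by exact_mod_cast this)

theorem IndepCountBound.succ_nat {d k L L' : ℕ} (h : IndepCountBound d k L)
    (hL : (d + 1) * L < (L' + 1) * (k + 1)) : IndepCountBound (d + 1) (k + 1) L' := by
  refine (h.succ (Nat.cast_nonneg L)).floor ?_
  rw [div_lt_iff₀ (by positivity)]
  exact_mod_cast hL

/-- The factor `(m + 1) / (t + 1)` lost at each step is exactly the growth of the binomial
coefficient. -/
theorem IndepCountBound.add {m t : ℕ} {β : ℝ} (hβ : 0 ≤ β)
    (h : IndepCountBound m t (β * m.choose t)) (j : ℕ) :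
    IndepCountBound (m + j) (t + j) (β * (m + j).choose (t + j)) := by
  induction j with
  | zero => exact h
  | succ j ih =>
    refine (ih.succ (by positivity)).mono (le_of_eq ?_)
    have := Nat.add_one_mul_choose_eq (m + j) (t + j)
    have h' : ((m + j : ℕ) + 1 : ℝ) * ((m + j).choose (t + j) : ℝ) =
        ((m + j + 1).choose (t + j + 1) : ℝ) * ((t + j : ℕ) + 1) := by exact_mod_cast this
    rw [div_eq_iff (by positivity)]
    rw [show m + (j + 1) = m + j + 1 by ring, show t + (j + 1) = t + j + 1 by ring]
    linear_combination β * h'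

theorem indepCountBound_two (d L : ℕ) (h : d ^ 2 < 3 * (L + 1)) : IndepCountBound d 2 L := by
  refine (indepCountBound_basisRatio d 2).floor ?_
  have e : basisRatio 2 = 2 / 3 := by norm_num [basisRatio]
  have : (d : ℝ) ^ 2 < 3 * (L + 1) := by exact_mod_cast h
  rw [e, Nat.factorial_two]
  push_cast
  linarith

theorem indepCountBound_of_choose_le {d k L : ℕ} (h : d.choose k ≤ L) : IndepCountBound d k L :=
  (indepCountBound_choose d k).mono (by exact_mod_cast h)

theorem indepCountBound_five {k : ℕ} (hk : k ≤ 5) : IndepCountBound 5 k (8 : ℕ) := by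
  interval_cases k
  · exact indepCountBound_of_choose_le (by decide)
  · exact indepCountBound_of_choose_le (by decide)
  · exact indepCountBound_two _ _ (by norm_num)
  -- Integrality is used twice: 16/3 rounds down to 5, then 25/3 to 8.
  · exact (indepCountBound_two 4 5 (by norm_num)).succ_nat (by norm_num)
  · exact indepCountBound_of_choose_le (by decide)
  · exact indepCountBound_of_choose_le (by decide)

theorem indepCountBound_six {k : ℕ} (hk : k ≤ 6) : IndepCountBound 6 k (16 : ℕ) := by
  rcases k with _ | _ | _ | k
  · exact indepCountBound_of_choose_le (by decide)
  · exact indepCountBound_of_choose_le (by decide)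
  · exact indepCountBound_two _ _ (by norm_num)
  · exact (indepCountBound_five (by omega)).succ_nat (by omega)

theorem indepCountBound_seven {k : ℕ} (hk : k ≤ 7) : IndepCountBound 7 k (28 : ℕ) := by
  rcases k with _ | _ | _ | _ | k
  · exact indepCountBound_of_choose_le (by decide)
  · exact indepCountBound_of_choose_le (by decide)
  · exact indepCountBound_two _ _ (by norm_num)
  · exact (indepCountBound_two 6 12 (by norm_num)).succ_nat (by norm_num)
  · exact (indepCountBound_six (by omega)).succ_nat (by omega)

/-! ### Words as sets. -/

/-- Binary words correspond to the sets of positions of their ones. -/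
def wordEquivFinset (n : ℕ) : (Fin n → Bool) ≃ Finset (Fin n) where
  toFun w := Finset.univ.filter fun i => w i = true
  invFun X i := decide (i ∈ X)
  left_inv w := by funext i; simp
  right_inv X := by ext i; simp

theorem mem_wordEquivFinset {n : ℕ} (w : Fin n → Bool) (i : Fin n) :
    i ∈ wordEquivFinset n w ↔ w i = true := by
  simp [wordEquivFinset]

theorem wordEquivFinset_sdiff_eq_iff {n : ℕ} (x w : Fin n → Bool) (S : Finset (Fin n)) :
    wordEquivFinset n x \ S = wordEquivFinset n w \ S ↔ ∀ i, i ∉ S → x i = w i := by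
  simp only [Finset.ext_iff, Finset.mem_sdiff, mem_wordEquivFinset]
  refine forall_congr' fun i => ?_
  by_cases hi : i ∈ S
  · simp [hi]
  · simp only [hi, not_false_eq_true, and_true, forall_const]
    exact Bool.eq_iff_iff.symm

theorem isErasureCode_iff_map {d L n : ℕ} (C : Finset (Fin n → Bool)) :
    IsErasureCode d L n C ↔ ∀ W ∈ C.map (wordEquivFinset n).toEmbedding,
      ∀ S : Finset (Fin n), S.card = d →
        ((C.map (wordEquivFinset n).toEmbedding).filter fun X => X \ S = W \ S).card ≤ L := by
  unfold IsErasureCode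
  simp only [Finset.forall_mem_map, Finset.filter_map, Finset.card_map]
  refine forall₂_congr fun w _ => forall₂_congr fun S _ => ?_
  have : (C.filter fun x => ∀ i, i ∉ S → x i = w i) =
      C.filter ((fun X => X \ S = (wordEquivFinset n).toEmbedding w \ S) ∘
        (wordEquivFinset n).toEmbedding) := by
    refine Finset.filter_congr fun x _ => ?_
    exact (wordEquivFinset_sdiff_eq_iff x w S).symm
  rw [this]

/-! ### Random vectors over 𝔽₂. -/

/-- The product `∏_{j=1}^{r} (1 - 2^{-j})`. -/
noncomputable def eulerProduct (r : ℕ) : ℝ := ∏ j ∈ Finset.range r, (1 - (1 / 2 : ℝ) ^ (j + 1))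

theorem eulerProduct_succ (r : ℕ) :
    eulerProduct (r + 1) = eulerProduct r * (1 - (1 / 2 : ℝ) ^ (r + 1)) :=
  Finset.prod_range_succ _ _

theorem eulerProduct_pos (r : ℕ) : 0 < eulerProduct r := by
  refine Finset.prod_pos fun j _ => ?_
  rw [sub_pos]
  exact pow_lt_one₀ (by norm_num) (by norm_num) (by omega)

theorem antitone_eulerProduct : Antitone eulerProduct := by
  refine antitone_nat_of_succ_le fun r => ?_
  rw [eulerProduct_succ]
  refine mul_le_of_le_one_right (eulerProduct_pos r).le ?_
  rw [sub_le_self_iff]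
  positivity

/-- The bound `∏ (1 - x_j) ≥ 1 - ∑ x_j` for the factors after the first `m`, with the geometric sum
kept exact so that the induction closes. -/
theorem eulerProduct_add_ge (m k : ℕ) :
    eulerProduct m * (1 - (1 / 2 : ℝ) ^ m + (1 / 2 : ℝ) ^ (m + k)) ≤ eulerProduct (m + k) := by
  induction k with
  | zero => simp
  | succ k ih =>
    rw [← add_assoc, eulerProduct_succ]
    have h1 : (0 : ℝ) ≤ 1 - (1 / 2 : ℝ) ^ (m + k + 1) := by
      rw [sub_nonneg]; exact pow_le_one₀ (by norm_num) (by norm_num)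
    refine le_trans ?_ (mul_le_mul_of_nonneg_right ih h1)
    rw [mul_assoc]
    refine mul_le_mul_of_nonneg_left ?_ (eulerProduct_pos m).le
    have h2 : (1 / 2 : ℝ) ^ (m + k) ≤ (1 / 2 : ℝ) ^ m :=
      pow_le_pow_of_le_one (by norm_num) (by norm_num) (by omega)
    have h3 : (0 : ℝ) ≤ (1 / 2 : ℝ) ^ (m + k) := by positivity
    rw [pow_succ]
    nlinarith [mul_nonneg h3 (sub_nonneg.2 h2)]

theorem eulerProduct_ge (m r : ℕ) (h : m ≤ r) :
    eulerProduct m * (1 - (1 / 2 : ℝ) ^ m) ≤ eulerProduct r := by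
  obtain ⟨k, rfl⟩ := Nat.exists_eq_add_of_le h
  refine le_trans (mul_le_mul_of_nonneg_left ?_ (eulerProduct_pos m).le) (eulerProduct_add_ge m k)
  rw [le_add_iff_nonneg_right]
  positivity

theorem quarter_le_eulerProduct (r : ℕ) : 1 / 4 ≤ eulerProduct r := by
  rcases r with _ | r
  · norm_num [eulerProduct]
  · refine le_trans ?_ (eulerProduct_ge 1 (r + 1) (by omega))
    norm_num [eulerProduct]

theorem prod_two_pow_sub (r : ℕ) :
    ∏ i ∈ Finset.range r, ((2 : ℝ) ^ r - 2 ^ i) = (2 ^ r) ^ r * eulerProduct r := by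
  induction r with
  | zero => simp [eulerProduct]
  | succ r ih =>
    rw [Finset.prod_range_succ', ← Finset.prod_congr rfl
      (fun i _ => show 2 * ((2 : ℝ) ^ r - 2 ^ i) = 2 ^ (r + 1) - 2 ^ (i + 1) by ring),
      Finset.prod_mul_distrib, Finset.prod_const, Finset.card_range, ih, eulerProduct_succ,
      one_div_pow]
    field_simp
    ring

open Classical in
theorem two_pow_mul_le_card_linearIndepOn {ι : Type*} [Fintype ι] [DecidableEq ι] {r : ℕ} {T : Finset ι}
    (hT : T.card = r) :
    ((2 : ℝ) ^ r) ^ Fintype.card ι * (1 / 4) ≤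
      ((Finset.univ.filter fun v : ι → (Fin r → ZMod 2) =>
        LinearIndepOn (ZMod 2) v (T : Set ι)).card : ℝ) := by
  set V := Fin r → ZMod 2
  have hV : Fintype.card V = 2 ^ r := by simp [V, ZMod.card]
  have hcard : (Fintype.card {s : Fin r → V // LinearIndependent (ZMod 2) s} : ℝ) =
      (2 ^ r) ^ r * eulerProduct r := by
    have h := card_linearIndependent (K := ZMod 2) (V := V) (k := r) (by simp [V])
    rw [Nat.card_eq_fintype_card, ZMod.card, show Module.finrank (ZMod 2) V = r by simp [V],
      Fin.prod_univ_eq_prod_range (fun i => 2 ^ r - 2 ^ i) r] at h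
    rw [← prod_two_pow_sub, h, Nat.cast_prod]
    refine Finset.prod_congr rfl fun i hi => ?_
    rw [Nat.cast_sub (Nat.pow_le_pow_right (by norm_num) (Finset.mem_range.1 hi).le)]
    simp
  let e : T ≃ Fin r := T.equivFinOfCardEq hT
  -- An independent `r`-tuple on `T`, with arbitrary vectors elsewhere; injectivity suffices for a
  -- lower bound.
  let g : {s : Fin r → V // LinearIndependent (ZMod 2) s} × ({i // i ∉ T} → V) →
      {v : ι → V // LinearIndepOn (ZMod 2) v (T : Set ι)} := fun p =>
    ⟨fun i => if h : i ∈ T then p.1.1 (e ⟨i, h⟩) else p.2 ⟨i, h⟩, by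
      have : LinearIndependent (ZMod 2) (p.1.1 ∘ e) := p.1.2.comp _ e.injective
      unfold LinearIndepOn
      have h' : (fun i : (T : Set ι) => (if h : i.1 ∈ T then p.1.1 (e ⟨i.1, h⟩) else
          p.2 ⟨i.1, h⟩ : V)) = p.1.1 ∘ e := by
        funext i
        exact dif_pos i.2
      exact h' ▸ this⟩
  have hg : Function.Injective g := by
    rintro ⟨⟨s, hs⟩, u⟩ ⟨⟨s', hs'⟩, u'⟩ h
    have h' := congrArg Subtype.val h
    simp only [g] at h'
    have h1 : s = s' := by
      funext j
      have := congrFun h' (e.symm j).1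
      simpa using this
    have h2 : u = u' := by
      funext j
      have := congrFun h' j.1
      simpa [j.2] using this
    subst h1 h2
    rfl
  have hle := Fintype.card_le_of_injective g hg
  rw [Fintype.card_prod, Fintype.card_fun, hV, Fintype.card_subtype_compl,
    Fintype.card_coe, hT, Fintype.card_subtype (fun v : ι → V => LinearIndepOn (ZMod 2) v _)] at hle
  have hle' : (Fintype.card {s : Fin r → V // LinearIndependent (ZMod 2) s} : ℝ) *
      (2 ^ r) ^ (Fintype.card ι - r) ≤ ((Finset.univ.filter fun v : ι → V =>
        LinearIndepOn (ZMod 2) v (T : Set ι)).card : ℝ) := by exact_mod_cast hle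
  refine le_trans ?_ hle'
  have hr : r ≤ Fintype.card ι := hT ▸ Finset.card_le_univ T
  rw [hcard]
  calc ((2 : ℝ) ^ r) ^ Fintype.card ι * (1 / 4)
      ≤ ((2 : ℝ) ^ r) ^ Fintype.card ι * eulerProduct r :=
        mul_le_mul_of_nonneg_left (quarter_le_eulerProduct r) (by positivity)
    _ = _ := by
        nth_rewrite 1 [← Nat.add_sub_cancel' hr]
        rw [pow_add]; ring

/-- Some `n` vectors in `𝔽₂^r` have at least a quarter of their `r`-subsets independent. -/
theorem exists_choose_le_four_mul_indepCount (n r : ℕ) :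
    ∃ v : Fin n → (Fin r → ZMod 2), (n.choose r : ℝ) / 4 ≤ indepCount v Finset.univ r := by
  classical
  -- First moment: sum over all `v` and exchange the order, so that each `r`-set contributes at
  -- least a quarter of all `v`.
  by_contra! hlt
  have h1 : ∑ v : Fin n → (Fin r → ZMod 2), (indepCount v Finset.univ r : ℝ) <
      ∑ v : Fin n → (Fin r → ZMod 2), (n.choose r : ℝ) / 4 :=
    Finset.sum_lt_sum_of_nonempty Finset.univ_nonempty fun v _ => hlt v
  have h2 : ∑ v : Fin n → (Fin r → ZMod 2), (indepCount v Finset.univ r : ℝ) =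
      ∑ T ∈ Finset.powersetCard r (Finset.univ : Finset (Fin n)),
        ((Finset.univ.filter fun v : Fin n → (Fin r → ZMod 2) =>
          LinearIndepOn (ZMod 2) v (T : Set (Fin n))).card : ℝ) := by
    rw [← Nat.cast_sum, ← Nat.cast_sum]
    exact congrArg Nat.cast (Finset.sum_card_bipartiteAbove_eq_sum_card_bipartiteBelow
      (fun (v : Fin n → (Fin r → ZMod 2)) (T : Finset (Fin n)) =>
        LinearIndepOn (ZMod 2) v (T : Set (Fin n))))
  rw [h2] at h1
  refine h1.not_ge ?_
  refine le_trans (le_of_eq ?_) (Finset.card_nsmul_le_sum _ _ _ fun T hT =>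
    two_pow_mul_le_card_linearIndepOn (Finset.mem_powersetCard.1 hT).2)
  have hc : Fintype.card (Fin n → Fin r → ZMod 2) = (2 ^ r) ^ n := by
    rw [Fintype.card_fun, Fintype.card_fun, ZMod.card, Fintype.card_fin, Fintype.card_fin]
  rw [Finset.sum_const, Finset.card_univ, hc, Finset.card_powersetCard, Finset.card_univ,
    Fintype.card_fin, nsmul_eq_mul, nsmul_eq_mul]
  push_cast
  ring

/-! ### The code built from independent columns. -/

open Classical in
/-- The index sets of size congruent to `a` modulo `d + 1` selecting linearly independent columns,
where `v r` is used for sets of size `r`. -/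
noncomputable def independentFamily {n : ℕ} (v : ∀ r, Fin n → (Fin r → ZMod 2)) (d a : ℕ) :
    Finset (Finset (Fin n)) :=
  Finset.univ.filter fun W =>
    W.card % (d + 1) = a ∧ LinearIndepOn (ZMod 2) (v W.card) (W : Set (Fin n))

theorem mem_independentFamily {n : ℕ} {v : ∀ r, Fin n → (Fin r → ZMod 2)} {d a : ℕ}
    {W : Finset (Fin n)} : W ∈ independentFamily v d a ↔
      W.card % (d + 1) = a ∧ LinearIndepOn (ZMod 2) (v W.card) (W : Set (Fin n)) := by
  simp [independentFamily]

theorem card_filter_independentFamily_le {n : ℕ} (v : ∀ r, Fin n → (Fin r → ZMod 2)) {d a L : ℕ}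
    (h : ∀ k ≤ d, IndepCountBound d k L) {W : Finset (Fin n)} (hW : W ∈ independentFamily v d a)
    {S : Finset (Fin n)} (hS : S.card = d) :
    ((independentFamily v d a).filter fun X => X \ S = W \ S).card ≤ L := by
  classical
  rw [mem_independentFamily] at hW
  set r := W.card with hr
  set W₀ := W \ S with hW₀
  have hc : ∀ X : Finset (Fin n), (X \ S).card + (X ∩ S).card = X.card := fun X =>
    Finset.card_sdiff_add_card_inter X S
  have hcW : W₀.card + (W ∩ S).card = r := hc W
  have hle : ∀ X : Finset (Fin n), (X ∩ S).card ≤ d := fun X =>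
    hS ▸ Finset.card_le_card Finset.inter_subset_right
  set U := Submodule.span (ZMod 2) (v r '' (W₀ : Set (Fin n))) with hU
  have hrank : Module.finrank (ZMod 2) ((Fin r → ZMod 2) ⧸ U) = (W ∩ S).card := by
    have h1 := Submodule.finrank_quotient_add_finrank U
    have hli : LinearIndepOn (ZMod 2) (v r) (W₀ : Set (Fin n)) :=
      hW.2.mono (by exact_mod_cast Finset.sdiff_subset)
    have h2 : Module.finrank (ZMod 2) U = W₀.card := by
      have := finrank_span_eq_card hli
      rw [← Set.image_eq_range] at this
      rw [hU, this]
      exact Fintype.card_coe W₀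
    rw [h2, Module.finrank_fin_fun] at h1
    omega
  have : Finite ((Fin r → ZMod 2) ⧸ U) := Finite.of_surjective _ (Submodule.mkQ_surjective _)
  have hb := h _ (hle W) (Fin n) _ hrank (Submodule.mkQ U ∘ v r) S hS.le
  refine le_trans ?_ (Nat.cast_le.1 hb)
  unfold indepCount
  refine Finset.card_le_card_of_injOn (fun X => X ∩ S) ?_ ?_
  · intro X hX
    rw [Finset.mem_coe, Finset.mem_filter, mem_independentFamily] at hX
    obtain ⟨⟨hXa, hXl⟩, hXS⟩ := hX
    -- The sizes are congruent mod `d + 1`, and so are the sizes of the traces on `S`, which lie in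
    -- `[0, d]`; hence they agree.
    have hcard : X.card = r := by
      have e1 := hc X
      rw [hXS] at e1
      have e3 := hle X
      have e4 := hle W
      have e5 : X.card ≡ r [MOD d + 1] := hXa.trans hW.1.symm
      have e6 : (X ∩ S).card ≡ (W ∩ S).card [MOD d + 1] := by
        rw [← e1, ← hcW] at e5
        exact Nat.ModEq.add_left_cancel' _ e5
      have := e6.eq_of_lt_of_lt (by omega) (by omega)
      omega
    rw [hcard] at hXl
    rw [Finset.mem_coe, Finset.mem_filter, Finset.mem_powersetCard]
    refine ⟨⟨Finset.inter_subset_right, ?_⟩, ?_⟩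
    · have e1 := hc X
      rw [hXS] at e1
      show (X ∩ S).card = _
      omega
    · have hu : (X : Set (Fin n)) = (W₀ : Set (Fin n)) ∪ ((X ∩ S : Finset (Fin n)) : Set (Fin n)) := by
        rw [← hXS, ← Finset.coe_union, Finset.sdiff_union_inter]
      have hd : Disjoint (W₀ : Set (Fin n)) ((X ∩ S : Finset (Fin n)) : Set (Fin n)) := by
        rw [← hXS]
        exact_mod_cast Finset.disjoint_sdiff_inter X S
      rw [hu, linearIndepOn_union_iff_quotient hd] at hXl
      exact hXl.2
  · intro X hX Y hY hXY
    rw [Finset.mem_coe, Finset.mem_filter] at hX hY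
    rw [← Finset.sdiff_union_inter X S, ← Finset.sdiff_union_inter Y S, hX.2, hY.2]
    exact congrArg (W₀ ∪ ·) hXY

/-- A quarter of the sets survive at each size, and one of the `d + 1` residue classes holds its
share. -/
theorem exists_card_independentFamily_ge (n d : ℕ) :
    ∃ (v : ∀ r, Fin n → (Fin r → ZMod 2)) (a : ℕ),
      1 / (4 * ((d : ℝ) + 1)) * 2 ^ n ≤ ((independentFamily v d a).card : ℝ) := by
  classical
  choose v hv using exists_choose_le_four_mul_indepCount n
  refine ⟨v, ?_⟩
  set G : Finset (Finset (Fin n)) := Finset.univ.filter fun W =>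
    LinearIndepOn (ZMod 2) (v W.card) (W : Set (Fin n)) with hG
  have hGcard : (2 : ℝ) ^ n / 4 ≤ G.card := by
    have h1 : G.card = ∑ r ∈ Finset.range (n + 1), indepCount (v r) Finset.univ r := by
      rw [Finset.card_eq_sum_card_fiberwise (f := Finset.card) (t := Finset.range (n + 1))]
      · refine Finset.sum_congr rfl fun r _ => ?_
        unfold indepCount
        congr 1
        ext W
        simp only [hG, Finset.mem_filter, Finset.mem_univ, true_and, Finset.mem_powersetCard,
          Finset.subset_univ]
        constructor
        · rintro ⟨h, rfl⟩; exact ⟨rfl, h⟩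
        · rintro ⟨rfl, h⟩; exact ⟨h, rfl⟩
      · intro W _
        have := Finset.card_le_univ W
        rw [Fintype.card_fin] at this
        rw [Finset.mem_coe, Finset.mem_range]
        omega
    have h2 : ((2 : ℝ) ^ n) = ∑ r ∈ Finset.range (n + 1), (n.choose r : ℝ) := by
      exact_mod_cast (Nat.sum_range_choose n).symm
    rw [h1, h2, Finset.sum_div, Nat.cast_sum]
    exact Finset.sum_le_sum fun r _ => hv r
  by_contra! hlt
  have h3 : G.card = ∑ a ∈ Finset.range (d + 1), (independentFamily v d a).card := by
    rw [Finset.card_eq_sum_card_fiberwise (f := fun W => W.card % (d + 1))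
      (t := Finset.range (d + 1))]
    · refine Finset.sum_congr rfl fun a _ => ?_
      congr 1
      ext W
      simp only [hG, Finset.mem_filter, Finset.mem_univ, true_and, mem_independentFamily]
      exact and_comm
    · intro W _
      rw [Finset.mem_coe, Finset.mem_range]
      exact Nat.mod_lt _ (Nat.succ_pos d)
  have h4 : (G.card : ℝ) < ∑ a ∈ Finset.range (d + 1), 1 / (4 * ((d : ℝ) + 1)) * 2 ^ n := by
    rw [h3, Nat.cast_sum]
    exact Finset.sum_lt_sum_of_nonempty (by simp) fun a _ => hlt a
  rw [Finset.sum_const, Finset.card_range, nsmul_eq_mul] at h4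
  refine h4.not_ge (le_trans (le_of_eq ?_) hGcard)
  push_cast
  field_simp

theorem hasDenseErasureCodes_of_indepCountBound {d L : ℕ} (h : ∀ k ≤ d, IndepCountBound d k L) :
    HasDenseErasureCodes d L := by
  refine ⟨1 / (4 * ((d : ℝ) + 1)), by positivity, fun n => ?_⟩
  obtain ⟨v, a, hcard⟩ := exists_card_independentFamily_ge n d
  refine ⟨(independentFamily v d a).map (wordEquivFinset n).symm.toEmbedding, ?_, ?_⟩
  · rw [isErasureCode_iff_map]
    have e : ((independentFamily v d a).map (wordEquivFinset n).symm.toEmbedding).map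
        (wordEquivFinset n).toEmbedding = independentFamily v d a := by
      rw [Finset.map_map]
      convert Finset.map_refl
      ext x : 1
      simp
    rw [e]
    exact fun W hW S hS => card_filter_independentFamily_le v h hW hS
  · rwa [Finset.card_map]

theorem erasureListSize_le_of_indepCountBound {d : ℕ} {B : ℝ}
    (h : ∀ k ≤ d, IndepCountBound d k B) : (erasureListSize d : ℝ) ≤ B := by
  -- The empty family of vectors shows `B` to be nonnegative, as the floor requires.
  have hB : 0 ≤ B := (Nat.cast_nonneg _).trans
    (h d le_rfl Empty (Fin d → ZMod 2) (Module.finrank_fin_fun _) Empty.elim ∅ (by simp))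
  have h1 : erasureListSize d ≤ ⌊B⌋₊ := Nat.sInf_le
    (hasDenseErasureCodes_of_indepCountBound fun k hk => (h k hk).floor (Nat.lt_floor_add_one B))
  exact (Nat.cast_le.2 h1).trans (Nat.floor_le hB)

/-! ### The constant c. -/

theorem basisRatio_succ_mul (t : ℕ) :
    basisRatio (t + 1) * (1 - (1 / 2 : ℝ) ^ (t + 1)) ^ t = eulerProduct t := by
  induction t with
  | zero => simp [basisRatio, eulerProduct]
  | succ t ih =>
    have h2 : (1 : ℝ) < 2 ^ (t + 1 + 1) := one_lt_pow₀ one_lt_two (by omega)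
    have h2' : (2 : ℝ) ^ (t + 1 + 1) - 1 ≠ 0 := by linarith
    have e : (1 - 1 / ((2 : ℝ) ^ (t + 1 + 1) - 1)) * (1 - (1 / 2 : ℝ) ^ (t + 1 + 1)) =
        1 - (1 / 2 : ℝ) ^ (t + 1) := by
      rw [one_div_pow, one_div_pow]
      field_simp
      ring
    rw [basisRatio_succ, eulerProduct_succ, ← ih, mul_assoc, ← mul_pow, e]
    ring

theorem tendsto_one_sub_half_pow_pow :
    Tendsto (fun t : ℕ => (1 - (1 / 2 : ℝ) ^ (t + 1)) ^ t) atTop (𝓝 1) := by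
  have h1 : Tendsto (fun t : ℕ => 1 - (t : ℝ) * (1 / 2 : ℝ) ^ t) atTop (𝓝 1) := by
    have := tendsto_self_mul_const_pow_of_abs_lt_one (r := (1 / 2 : ℝ))
      (by rw [abs_of_pos] <;> norm_num)
    simpa using this.const_sub 1
  refine tendsto_of_tendsto_of_tendsto_of_le_of_le h1 tendsto_const_nhds (fun t => ?_) fun t => ?_
  · have h0 : (0 : ℝ) ≤ (1 / 2 : ℝ) ^ (t + 1) := by positivity
    have h3 : (1 / 2 : ℝ) ^ (t + 1) ≤ 1 := pow_le_one₀ (by norm_num) (by norm_num)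
    have h4 := one_add_mul_le_pow (show (-2 : ℝ) ≤ -(1 / 2 : ℝ) ^ (t + 1) by linarith) t
    have h5 : (1 / 2 : ℝ) ^ (t + 1) ≤ (1 / 2 : ℝ) ^ t :=
      pow_le_pow_of_le_one (by norm_num) (by norm_num) (by omega)
    have h6 := mul_le_mul_of_nonneg_left h5 (Nat.cast_nonneg (α := ℝ) t)
    rw [← sub_eq_add_neg] at h4
    simp only
    linarith
  · refine pow_le_one₀ ?_ ?_
    · rw [sub_nonneg]; exact pow_le_one₀ (by norm_num) (by norm_num)
    · rw [sub_le_self_iff]; positivity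

theorem exists_tendsto_basisRatio : ∃ c : ℝ, Tendsto basisRatio atTop (𝓝 c) ∧ |c - 0.29| < 0.005 := by
  have hbdd : BddBelow (Set.range eulerProduct) :=
    ⟨0, by rintro _ ⟨r, rfl⟩; exact (eulerProduct_pos r).le⟩
  have hlim := tendsto_atTop_ciInf antitone_eulerProduct hbdd
  set c := ⨅ r, eulerProduct r
  refine ⟨c, ?_, ?_⟩
  · rw [← tendsto_add_atTop_iff_nat 1]
    have h := hlim.div tendsto_one_sub_half_pow_pow one_ne_zero
    rw [div_one] at h
    refine h.congr fun t => ?_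
    have hne : (1 - (1 / 2 : ℝ) ^ (t + 1)) ^ t ≠ 0 := by
      refine pow_ne_zero _ (sub_ne_zero.2 (ne_of_gt ?_))
      exact pow_lt_one₀ (by norm_num) (by norm_num) (by omega)
    rw [Pi.div_apply, div_eq_iff hne, basisRatio_succ_mul]
  -- Eight factors determine `c` up to a relative error of `2^{-8}`, enough for two decimals.
  · have h1 : c ≤ eulerProduct 8 := ciInf_le hbdd 8
    have h2 : eulerProduct 8 * (1 - (1 / 2 : ℝ) ^ 8) ≤ c :=
      ge_of_tendsto hlim (eventually_atTop.2 ⟨8, fun r hr => eulerProduct_ge 8 r hr⟩)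
    have h3 : eulerProduct 8 < 0.295 := by norm_num [eulerProduct, Finset.prod_range_succ]
    have h4 : 0.285 < eulerProduct 8 * (1 - (1 / 2 : ℝ) ^ 8) := by
      norm_num [eulerProduct, Finset.prod_range_succ]
    rw [abs_lt]
    constructor <;> linarith

/-! ### Asymptotics for large d. -/

theorem eventually_pow_le_mul_choose_middle (K : ℕ) {c : ℝ} (hc : 0 < c) :
    ∀ᶠ d : ℕ in atTop, (d : ℝ) ^ K ≤ c * (d.choose (d / 2) : ℝ) := by
  have h := (tendsto_pow_const_div_const_pow_of_one_lt (K + 1) (one_lt_two (α := ℝ))).eventually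
    (gt_mem_nhds (half_pos hc))
  filter_upwards [h, eventually_ge_atTop 1] with d hd hd1
  have h1 : (2 : ℝ) ^ d ≤ (d + 1) * d.choose (d / 2) := by
    have h2 : 2 ^ d ≤ (d + 1) * d.choose (d / 2) := by
      rw [← Nat.sum_range_choose]
      refine (Finset.sum_le_card_nsmul _ _ _ fun i _ => Nat.choose_le_middle i d).trans ?_
      simp
    exact_mod_cast h2
  have hdpos : (1 : ℝ) ≤ d := by exact_mod_cast hd1
  rw [div_lt_iff₀ (by positivity)] at hd
  have h3 : (d : ℝ) ^ K * d ≤ c * (d.choose (d / 2) : ℝ) * d := by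
    rw [← pow_succ]
    refine hd.le.trans ((mul_le_mul_of_nonneg_left h1 (by positivity)).trans ?_)
    have : (0 : ℝ) ≤ c * d.choose (d / 2) := by positivity
    nlinarith
  exact le_of_mul_le_mul_right h3 (by linarith)

theorem eventually_indepCountBound {β : ℝ} {t : ℕ} (hβ : basisRatio t < β) :
    ∀ᶠ m : ℕ in atTop, IndepCountBound m t (β * m.choose t) := by
  have hb0 : 0 ≤ basisRatio t := basisRatio_nonneg t
  have h := (Asymptotics.isEquivalent_iff_tendsto_one ?_).1 (isEquivalent_choose t)
  · have h2 := (h.const_mul β).eventually (lt_mem_nhds (show basisRatio t < β * 1 by simpa))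
    filter_upwards [h2, eventually_gt_atTop 0] with m hm hm0
    refine (indepCountBound_basisRatio m t).mono ?_
    have hm' : (0 : ℝ) < m := by exact_mod_cast hm0
    simp only [Pi.div_apply] at hm
    rw [← mul_div_assoc, lt_div_iff₀ (by positivity)] at hm
    rw [mul_div_assoc]
    exact hm.le
  · filter_upwards [eventually_gt_atTop 0] with m hm
    have hm' : (0 : ℝ) < m := by exact_mod_cast hm
    positivity

/-- Fix `t` with `basisRatio t < β`. For `k` near `0` or `d`, the binomial coefficient is polynomial
in `d`, hence negligible against the central one. Otherwise climb diagonally from `(d - k + t, t)`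
to `(d, k)`. -/
theorem eventually_erasureListSize_le {c β : ℝ} (hlim : Tendsto basisRatio atTop (𝓝 c))
    (hβ : c < β) (hβ0 : 0 < β) :
    ∀ᶠ d : ℕ in atTop, (erasureListSize d : ℝ) ≤ β * (d.choose (d / 2) : ℝ) := by
  obtain ⟨t, ht⟩ := (hlim.eventually (gt_mem_nhds hβ)).exists
  obtain ⟨M, hM⟩ := eventually_atTop.1 (eventually_indepCountBound ht)
  filter_upwards [eventually_pow_le_mul_choose_middle (t + M) hβ0, eventually_ge_atTop 1]
    with d hd hd1
  refine erasureListSize_le_of_indepCountBound fun k hk => ?_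
  have small : ∀ j, j ≤ t + M → (d.choose j : ℝ) ≤ β * (d.choose (d / 2) : ℝ) := by
    intro j hj
    refine le_trans ?_ hd
    exact_mod_cast (Nat.choose_le_pow d j).trans (Nat.pow_le_pow_right hd1 hj)
  by_cases hkt : k < t
  · exact (indepCountBound_choose d k).mono (small k (by omega))
  by_cases hkM : d - k < M
  · refine (indepCountBound_choose d k).mono ?_
    rw [← Nat.choose_symm hk]
    exact small _ (by omega)
  · push Not at hkt hkM
    have h := (hM (d - k + t) (by omega)).add hβ0.le (k - t)
    rw [show d - k + t + (k - t) = d by omega, show t + (k - t) = k by omega] at h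
    refine h.mono (mul_le_mul_of_nonneg_left ?_ hβ0.le)
    exact_mod_cast Nat.choose_le_middle k d

theorem exists_tendsto_zero_erasureListSize_le {c : ℝ} (hlim : Tendsto basisRatio atTop (𝓝 c))
    (hc : 0 < c) : ∃ δ : ℕ → ℝ, Tendsto δ atTop (𝓝 0) ∧
      ∀ d : ℕ, (erasureListSize d : ℝ) ≤ (c + δ d) * (d.choose (d / 2) : ℝ) := by
  have hpos : ∀ d : ℕ, (0 : ℝ) < d.choose (d / 2) := fun d => by
    exact_mod_cast Nat.choose_pos (Nat.div_le_self d 2)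
  -- Truncation at 0 is needed because the ratio is controlled only from above.
  refine ⟨fun d => max 0 (erasureListSize d / (d.choose (d / 2) : ℝ) - c), ?_, fun d => ?_⟩
  · rw [Metric.tendsto_nhds]
    intro ε hε
    filter_upwards [eventually_erasureListSize_le hlim (show c < c + ε / 2 by linarith)
      (by linarith)] with d hd
    rw [← div_le_iff₀ (hpos d)] at hd
    rw [Real.dist_eq, sub_zero, abs_of_nonneg (le_max_left _ _)]
    exact max_lt hε (by linarith)
  · have h := le_max_right 0 (erasureListSize d / (d.choose (d / 2) : ℝ) - c)
    rw [← div_le_iff₀ (hpos d)]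
    linarith

/-! ### The lower bound for d = 5. -/

/-- A dense bipartite relation contains a four-cycle. -/
theorem exists_four_cycle {α : Type*} [Fintype α] [DecidableEq α] (G : Finset (α × α))
    (h : 2 * Fintype.card α ^ 3 < G.card ^ 2) :
    ∃ x x' y y', x ≠ x' ∧ y ≠ y' ∧ (x, y) ∈ G ∧ (x, y') ∈ G ∧ (x', y) ∈ G ∧ (x', y') ∈ G := by
  by_contra! hno
  set N := Fintype.card α
  set nb : α → Finset α := fun x => Finset.univ.filter fun y => (x, y) ∈ G with hnb
  have h1 : G.card = ∑ x, (nb x).card := by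
    rw [Finset.card_eq_sum_card_fiberwise (f := Prod.fst) (t := Finset.univ) (by simp)]
    refine Finset.sum_congr rfl fun x _ => ?_
    refine Finset.card_bij' (fun p _ => p.2) (fun y _ => (x, y)) ?_ ?_ ?_ ?_
    · rintro ⟨a, b⟩ hp
      rw [Finset.mem_filter] at hp
      obtain ⟨hp, rfl⟩ := hp
      simpa [hnb] using hp
    · intro y hy
      simpa [hnb] using hy
    · rintro ⟨a, b⟩ hp
      rw [Finset.mem_filter] at hp
      rw [← hp.2]
    · intro y _
      rfl
  have h2 : G.card ^ 2 ≤ N * ∑ x, (nb x).card ^ 2 := by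
    rw [h1]
    exact sq_sum_le_card_mul_sum_sq
  have h3 : ∑ x, (nb x).card ^ 2 =
      ∑ q : α × α, (Finset.univ.filter fun x => (x, q.1) ∈ G ∧ (x, q.2) ∈ G).card := by
    have := Finset.sum_card_bipartiteAbove_eq_sum_card_bipartiteBelow
      (s := (Finset.univ : Finset α)) (t := (Finset.univ : Finset (α × α)))
      (fun x q => (x, q.1) ∈ G ∧ (x, q.2) ∈ G)
    refine Eq.trans ?_ this
    refine Finset.sum_congr rfl fun x _ => ?_
    rw [sq, ← Finset.card_product]
    congr 1
    ext q
    simp [hnb, Finset.bipartiteAbove]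
  -- Without a four-cycle, two distinct points have at most one common neighbour.
  have h4 : ∑ q : α × α, (Finset.univ.filter fun x => (x, q.1) ∈ G ∧ (x, q.2) ∈ G).card ≤
      ∑ q : α × α, (1 + if q.1 = q.2 then N else 0) := by
    refine Finset.sum_le_sum fun q _ => ?_
    split_ifs with hq
    · exact (Finset.card_le_univ _).trans (Nat.le_add_left _ _)
    · rw [add_zero, Finset.card_le_one]
      intro x hx x' hx'
      rw [Finset.mem_filter] at hx hx'
      by_contra hxx
      exact hno x x' q.1 q.2 hxx hq hx.2.1 hx.2.2 hx'.2.1 hx'.2.2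
  have h5 : ∑ q : α × α, (1 + if q.1 = q.2 then N else 0) = 2 * N ^ 2 := by
    rw [Finset.sum_add_distrib, Fintype.sum_prod_type (f := fun q => if q.1 = q.2 then N else 0)]
    simp [N]
    ring
  rw [h3] at h2
  have h6 := h2.trans (Nat.mul_le_mul_left N (h4.trans h5.le))
  have : N * (2 * N ^ 2) = 2 * N ^ 3 := by ring
  omega

section Triangles

variable {n : ℕ} (𝒜 : Finset (Finset (Fin n)))

/-- The elements of `U` whose removal yields a member of the family. -/
def removable (U : Finset (Fin n)) : Finset (Fin n) := U.filter fun x => U.erase x ∈ 𝒜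

/-- The triples of distinct elements outside `W` any two of which extend `W` to a member of the
family. -/
def triangles (W : Finset (Fin n)) : Finset (Fin n × Fin n × Fin n) :=
  Finset.univ.filter fun p => (p.1 ≠ p.2.1 ∧ p.1 ≠ p.2.2 ∧ p.2.1 ≠ p.2.2) ∧
    (p.1 ∉ W ∧ p.2.1 ∉ W ∧ p.2.2 ∉ W) ∧
    (W ∪ {p.1, p.2.1} ∈ 𝒜 ∧ W ∪ {p.1, p.2.2} ∈ 𝒜 ∧ W ∪ {p.2.1, p.2.2} ∈ 𝒜)

theorem sum_card_compl_le_sum_card_removable :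
    ∑ W ∈ 𝒜, Wᶜ.card ≤ ∑ U, (removable 𝒜 U).card := by
  rw [← Finset.card_sigma, ← Finset.card_sigma]
  refine Finset.card_le_card_of_injOn (fun p => ⟨insert p.2 p.1, p.2⟩) ?_ ?_
  · rintro ⟨W, x⟩ h
    rw [Finset.mem_coe, Finset.mem_sigma, Finset.mem_compl] at h
    rw [Finset.mem_coe, Finset.mem_sigma]
    refine ⟨Finset.mem_univ _, ?_⟩
    simp only [removable, Finset.mem_filter, Finset.mem_insert_self, true_and]
    rw [Finset.erase_insert h.2]
    exact h.1
  · rintro ⟨W, x⟩ h ⟨W', x'⟩ h' e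
    rw [Finset.mem_coe, Finset.mem_sigma, Finset.mem_compl] at h h'
    simp only [Sigma.mk.injEq, heq_eq_eq] at e
    obtain ⟨e, rfl⟩ := e
    have := congrArg (fun U => Finset.erase U x) e
    simp only [Finset.erase_insert h.2, Finset.erase_insert h'.2] at this
    rw [this]

/-- The triples of distinct removable elements. -/
def removableTriples (U : Finset (Fin n)) : Finset (Fin n × Fin n × Fin n) :=
  (removable 𝒜 U ×ˢ removable 𝒜 U ×ˢ removable 𝒜 U).filter fun p =>
    p.1 ≠ p.2.1 ∧ p.1 ≠ p.2.2 ∧ p.2.1 ≠ p.2.2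

/-- The error term covers the triples with a coincidence. -/
theorem card_removable_pow_three_le (U : Finset (Fin n)) :
    (removable 𝒜 U).card ^ 3 ≤ (removableTriples 𝒜 U).card + 3 * n ^ 2 := by
  have key : ∀ (P : Fin n × Fin n × Fin n → Prop) [DecidablePred P]
      (g : Fin n × Fin n × Fin n → Fin n × Fin n),
      (∀ p q, P p → P q → g p = g q → p = q) → (Finset.univ.filter P).card ≤ n ^ 2 := by
    intro P _ g hg
    have := Finset.card_le_card_of_injOn (s := Finset.univ.filter P) (t := Finset.univ) g
      (by simp) (fun p hp q hq e => hg p q (by simpa using hp) (by simpa using hq) e)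
    simpa [sq] using this
  have h1 := key (fun p => p.1 = p.2.1) (fun p => p.2) (by
    rintro ⟨a, b, c⟩ ⟨a', b', c'⟩ h h' e; simp_all)
  have h2 := key (fun p => p.1 = p.2.2) (fun p => p.2) (by
    rintro ⟨a, b, c⟩ ⟨a', b', c'⟩ h h' e; simp_all)
  have h3 := key (fun p => p.2.1 = p.2.2) (fun p => (p.1, p.2.1)) (by
    rintro ⟨a, b, c⟩ ⟨a', b', c'⟩ h h' e; simp_all)
  have hsub : removable 𝒜 U ×ˢ removable 𝒜 U ×ˢ removable 𝒜 U ⊆ removableTriples 𝒜 U ∪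
      ((Finset.univ.filter fun p => p.1 = p.2.1) ∪ ((Finset.univ.filter fun p => p.1 = p.2.2) ∪
        (Finset.univ.filter fun p => p.2.1 = p.2.2))) := by
    intro p hp
    simp only [removableTriples, Finset.mem_union, Finset.mem_filter, Finset.mem_univ, true_and]
    tauto
  have h := (Finset.card_le_card hsub).trans ((Finset.card_union_le _ _).trans
    (Nat.add_le_add_left ((Finset.card_union_le _ _).trans
      (Nat.add_le_add_left (Finset.card_union_le _ _) _)) _))
  rw [Finset.card_product, Finset.card_product] at h
  have e : (removable 𝒜 U).card ^ 3 =
    (removable 𝒜 U).card * ((removable 𝒜 U).card * (removable 𝒜 U).card) := by ring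
  omega

/-- With `W = U \ {x, y, z}`, adding two of the three elements back to `W` is the same as erasing
the third from `U`. -/
theorem sum_card_removableTriples_le :
    ∑ U, (removableTriples 𝒜 U).card ≤ ∑ W, (triangles 𝒜 W).card := by
  rw [← Finset.card_sigma, ← Finset.card_sigma]
  have mem : ∀ {U : Finset (Fin n)} {x y z : Fin n}, (x, y, z) ∈ removableTriples 𝒜 U →
      (x ∈ U ∧ y ∈ U ∧ z ∈ U) ∧ (U.erase x ∈ 𝒜 ∧ U.erase y ∈ 𝒜 ∧ U.erase z ∈ 𝒜) ∧
        (x ≠ y ∧ x ≠ z ∧ y ≠ z) := by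
    intro U x y z h
    simp only [removableTriples, removable, Finset.mem_filter, Finset.mem_product] at h
    tauto
  refine Finset.card_le_card_of_injOn (fun p => ⟨p.1 \ {p.2.1, p.2.2.1, p.2.2.2}, p.2⟩) ?_ ?_
  · rintro ⟨U, x, y, z⟩ h
    rw [Finset.mem_coe, Finset.mem_sigma] at h
    obtain ⟨⟨hx, hy, hz⟩, ⟨ax, ay, az⟩, hxy, hxz, hyz⟩ := mem h.2
    rw [Finset.mem_coe, Finset.mem_sigma]
    refine ⟨Finset.mem_univ _, ?_⟩
    simp only [triangles, Finset.mem_filter, Finset.mem_univ, true_and]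
    have ez : U \ {x, y, z} ∪ {x, y} = U.erase z := by
      ext i; simp only [Finset.mem_union, Finset.mem_sdiff, Finset.mem_insert,
        Finset.mem_singleton, Finset.mem_erase]; grind
    have ey : U \ {x, y, z} ∪ {x, z} = U.erase y := by
      ext i; simp only [Finset.mem_union, Finset.mem_sdiff, Finset.mem_insert,
        Finset.mem_singleton, Finset.mem_erase]; grind
    have ex : U \ {x, y, z} ∪ {y, z} = U.erase x := by
      ext i; simp only [Finset.mem_union, Finset.mem_sdiff, Finset.mem_insert,
        Finset.mem_singleton, Finset.mem_erase]; grind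
    refine ⟨⟨hxy, hxz, hyz⟩, by simp, ?_⟩
    rw [ex, ey, ez]
    exact ⟨az, ay, ax⟩
  · rintro ⟨U, x, y, z⟩ h ⟨U', x', y', z'⟩ h' e
    rw [Finset.mem_coe, Finset.mem_sigma] at h h'
    simp only [Sigma.mk.injEq, heq_eq_eq, Prod.mk.injEq] at e
    obtain ⟨e, rfl, rfl, rfl⟩ := e
    have hsub : ∀ {V : Finset (Fin n)}, (x, y, z) ∈ removableTriples 𝒜 V → {x, y, z} ⊆ V := by
      intro V hV
      obtain ⟨⟨hx, hy, hz⟩, -⟩ := mem hV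
      intro i hi
      simp only [Finset.mem_insert, Finset.mem_singleton] at hi
      rcases hi with rfl | rfl | rfl <;> assumption
    have hU : U = U' := by
      rw [← Finset.sdiff_union_of_subset (hsub (V := U) h.2), e,
        Finset.sdiff_union_of_subset (hsub (V := U') h'.2)]
    rw [hU]

/-- On average over all `U` at least `ε n / 2` elements are removable; the power mean inequality
passes to triples. -/
theorem exists_card_triangles_ge {ε : ℝ} (hε : 0 ≤ ε) (hcard : ε * 2 ^ n ≤ (𝒜.card : ℝ))
    (hlow : 𝒜.card * n ≤ 2 * ∑ W ∈ 𝒜, Wᶜ.card) :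
    ∃ W, (ε / 2) ^ 3 * (n : ℝ) ^ 3 - 3 * (n : ℝ) ^ 2 ≤ ((triangles 𝒜 W).card : ℝ) := by
  have h1 : ε / 2 * n * 2 ^ n ≤ ∑ U, ((removable 𝒜 U).card : ℝ) := by
    have h2 := hlow.trans (Nat.mul_le_mul_left 2 (sum_card_compl_le_sum_card_removable 𝒜))
    have h3 : (𝒜.card : ℝ) * n ≤ 2 * ∑ U, ((removable 𝒜 U).card : ℝ) := by exact_mod_cast h2
    have h4 := mul_le_mul_of_nonneg_right hcard (Nat.cast_nonneg (α := ℝ) n)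
    linarith
  -- The argument `2` yields the inequality for cubes.
  have h5 := pow_sum_div_card_le_sum_pow (s := (Finset.univ : Finset (Finset (Fin n))))
    (f := fun U => ((removable 𝒜 U).card : ℝ)) (fun _ _ => Nat.cast_nonneg _) 2
  have hu : ((Finset.univ : Finset (Finset (Fin n))).card : ℝ) = 2 ^ n := by simp
  rw [hu] at h5
  have h6 : (ε / 2 * n) ^ 3 * 2 ^ n ≤ ∑ U, ((removable 𝒜 U).card : ℝ) ^ 3 := by
    refine le_trans ?_ h5
    rw [le_div_iff₀ (by positivity)]
    refine le_trans (le_of_eq ?_) (pow_le_pow_left₀ (by positivity) h1 3)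
    ring
  have h7 : ∑ U, ((removable 𝒜 U).card : ℝ) ^ 3 ≤
      ∑ U, (((removableTriples 𝒜 U).card : ℝ) + 3 * (n : ℝ) ^ 2) :=
    Finset.sum_le_sum fun U _ => by exact_mod_cast card_removable_pow_three_le 𝒜 U
  have h8 : ∑ U, ((removableTriples 𝒜 U).card : ℝ) ≤ ∑ W, ((triangles 𝒜 W).card : ℝ) := by
    exact_mod_cast sum_card_removableTriples_le 𝒜
  by_contra! hlt
  have h9 : ∑ W, ((triangles 𝒜 W).card : ℝ) <
      ∑ _W : Finset (Fin n), ((ε / 2) ^ 3 * (n : ℝ) ^ 3 - 3 * (n : ℝ) ^ 2) :=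
    Finset.sum_lt_sum_of_nonempty Finset.univ_nonempty fun W _ => hlt W
  rw [Finset.sum_const, nsmul_eq_mul, hu] at h9
  rw [Finset.sum_add_distrib, Finset.sum_const, nsmul_eq_mul, hu] at h7
  have : (ε / 2 * n) ^ 3 * 2 ^ n = 2 ^ n * ((ε / 2) ^ 3 * (n : ℝ) ^ 3) := by ring
  linarith

variable {𝒜}

/-- Four triangles with a common vertex whose other vertices form a four-cycle give eight members
of the family in a five-dimensional subcube. -/
theorem exists_eight_le_card_of_triangles {W : Finset (Fin n)} {x x' y y' z : Fin n} (hx : x ≠ x')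
    (hy : y ≠ y') (h₁ : (x, y, z) ∈ triangles 𝒜 W) (h₂ : (x, y', z) ∈ triangles 𝒜 W)
    (h₃ : (x', y, z) ∈ triangles 𝒜 W) (h₄ : (x', y', z) ∈ triangles 𝒜 W) :
    ∃ X ∈ 𝒜, ∃ S : Finset (Fin n), S.card = 5 ∧ 8 ≤ (𝒜.filter fun Y => Y \ S = X \ S).card := by
  simp only [triangles, Finset.mem_filter, Finset.mem_univ, true_and] at h₁ h₂ h₃ h₄
  have hinj : Function.Injective ![x, x', y, y', z] := by
    intro i j hij
    fin_cases i <;> fin_cases j <;> simp at hij ⊢ <;> grind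
  let e : Fin 5 ↪ Fin n := ⟨![x, x', y, y', z], hinj⟩
  have hdisj : ∀ P : Finset (Fin 5), Disjoint (P.map e) W := by
    intro P
    rw [Finset.disjoint_left]
    intro i hi
    obtain ⟨j, -, rfl⟩ := Finset.mem_map.1 hi
    fin_cases j
    · exact h₁.2.1.1
    · exact h₃.2.1.1
    · exact h₁.2.1.2.1
    · exact h₂.2.1.2.1
    · exact h₁.2.1.2.2
  -- The wheel with hub 4 and rim 0-2-1-3: all pairs but `{0, 1}` and `{2, 3}`.
  let pairs : Finset (Finset (Fin 5)) :=
    {{0, 2}, {0, 3}, {1, 2}, {1, 3}, {0, 4}, {1, 4}, {2, 4}, {3, 4}}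
  have hpairs : pairs.card = 8 := by decide
  have hmem : ∀ P ∈ pairs, W ∪ P.map e ∈ 𝒜 := by
    intro P hP
    simp only [pairs, Finset.mem_insert, Finset.mem_singleton] at hP
    rcases hP with rfl | rfl | rfl | rfl | rfl | rfl | rfl | rfl <;>
      rw [Finset.map_insert, Finset.map_singleton]
    · exact h₁.2.2.1
    · exact h₂.2.2.1
    · exact h₃.2.2.1
    · exact h₄.2.2.1
    · exact h₁.2.2.2.1
    · exact h₃.2.2.2.1
    · exact h₁.2.2.2.2
    · exact h₂.2.2.2.2
  have hsd : ∀ P : Finset (Fin 5), (W ∪ P.map e) \ Finset.univ.map e = W := by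
    intro P
    rw [Finset.union_sdiff_distrib, Finset.sdiff_eq_self_of_disjoint (hdisj _).symm,
      Finset.sdiff_eq_empty_iff_subset.2 (Finset.map_subset_map.2 (Finset.subset_univ P)),
      Finset.union_empty]
  refine ⟨W ∪ ({0, 2} : Finset (Fin 5)).map e, hmem _ (by decide), Finset.univ.map e,
    by simp, ?_⟩
  rw [← hpairs]
  refine Finset.card_le_card_of_injOn (fun P => W ∪ P.map e) ?_ ?_
  · intro P hP
    rw [Finset.mem_coe, Finset.mem_filter, hsd, hsd]
    exact ⟨hmem P hP, rfl⟩
  · intro P _ Q _ hPQ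
    have := congrArg (fun X => X \ W) hPQ
    simp only [Finset.union_sdiff_distrib, Finset.sdiff_self, Finset.empty_union,
      Finset.sdiff_eq_self_of_disjoint (hdisj _)] at this
    exact Finset.map_injective e this

/-- By Cauchy–Schwarz some vertex `z` lies in enough triangles for its link to contain a four-cycle.
-/
theorem exists_eight_le_card_of_card_triangles {W : Finset (Fin n)}
    (h : 2 * n ^ 5 < (triangles 𝒜 W).card ^ 2) :
    ∃ X ∈ 𝒜, ∃ S : Finset (Fin n), S.card = 5 ∧ 8 ≤ (𝒜.filter fun Y => Y \ S = X \ S).card := by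
  set G : Fin n → Finset (Fin n × Fin n) := fun z =>
    Finset.univ.filter fun q => (q.1, q.2, z) ∈ triangles 𝒜 W with hG
  have hsum : (triangles 𝒜 W).card ≤ ∑ z, (G z).card := by
    rw [← Finset.card_sigma]
    refine Finset.card_le_card_of_injOn (fun p => ⟨p.2.2, (p.1, p.2.1)⟩) ?_ ?_
    · rintro ⟨x, y, z⟩ hp
      simpa [hG] using hp
    · rintro ⟨x, y, z⟩ _ ⟨x', y', z'⟩ _ e
      simp_all
  have hz : ∃ z, 2 * n ^ 3 < (G z).card ^ 2 := by
    by_contra! hle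
    have h1 : (triangles 𝒜 W).card ^ 2 ≤ n * ∑ z, (G z).card ^ 2 := by
      refine (Nat.pow_le_pow_left hsum 2).trans ?_
      simpa using sq_sum_le_card_mul_sum_sq (s := Finset.univ) (f := fun z => (G z).card)
    have h2 : ∑ z, (G z).card ^ 2 ≤ n * (2 * n ^ 3) := by
      simpa using Finset.sum_le_card_nsmul Finset.univ _ _ (fun z _ => hle z)
    have h3 := h1.trans (Nat.mul_le_mul_left n h2)
    have : n * (n * (2 * n ^ 3)) = 2 * n ^ 5 := by ring
    omega
  obtain ⟨z, hz⟩ := hz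
  obtain ⟨x, x', y, y', hx, hy, h₁, h₂, h₃, h₄⟩ := exists_four_cycle (G z) (by simpa using hz)
  simp only [hG, Finset.mem_filter, Finset.mem_univ, true_and] at h₁ h₂ h₃ h₄
  exact exists_eight_le_card_of_triangles hx hy h₁ h₂ h₃ h₄

theorem exists_eight_le_card_of_sum_compl {ε : ℝ} (hε : 0 < ε)
    (hn : 48 / ε ^ 3 + 512 / ε ^ 6 < n) (hcard : ε * 2 ^ n ≤ (𝒜.card : ℝ))
    (hlow : 𝒜.card * n ≤ 2 * ∑ W ∈ 𝒜, Wᶜ.card) :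
    ∃ X ∈ 𝒜, ∃ S : Finset (Fin n), S.card = 5 ∧ 8 ≤ (𝒜.filter fun Y => Y \ S = X \ S).card := by
  obtain ⟨W, hW⟩ := exists_card_triangles_ge 𝒜 hε.le hcard hlow
  refine exists_eight_le_card_of_card_triangles (W := W) ?_
  -- With `η = (ε / 2) ^ 3`, the first term makes `3 n²` less than half of `η n³`; the second makes
  -- the square of the remaining half exceed `2 n⁵`.
  have ha : (0 : ℝ) < 48 / ε ^ 3 := by positivity
  have hb : (0 : ℝ) < 512 / ε ^ 6 := by positivity
  have hn0 : (0 : ℝ) < n := by linarith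
  set η : ℝ := (ε / 2) ^ 3 with hη
  have hη0 : 0 < η := by positivity
  have h1 : 6 < η * n := by
    have : 48 / ε ^ 3 < n := by linarith
    rw [div_lt_iff₀ (by positivity)] at this
    have e : η * n = n * ε ^ 3 / 8 := by rw [hη]; ring
    linarith
  have h2 : 8 < η ^ 2 * n := by
    have : 512 / ε ^ 6 < n := by linarith
    rw [div_lt_iff₀ (by positivity)] at this
    have e : η ^ 2 * n = n * ε ^ 6 / 64 := by rw [hη]; ring
    linarith
  have h3 : η / 2 * n ^ 3 ≤ ((triangles 𝒜 W).card : ℝ) := by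
    refine le_trans ?_ hW
    nlinarith [mul_lt_mul_of_pos_right h1 (pow_pos hn0 2)]
  have h4 : (2 * (n : ℝ) ^ 5) < ((triangles 𝒜 W).card : ℝ) ^ 2 := by
    refine lt_of_lt_of_le ?_ (pow_le_pow_left₀ (by positivity) h3 2)
    have := mul_lt_mul_of_pos_right h2 (pow_pos hn0 5)
    nlinarith
  exact_mod_cast h4

/-- The family or its family of complements has average size at most `n / 2`, and complementation
preserves agreement outside `S`. -/
theorem exists_eight_le_card {ε : ℝ} (hε : 0 < ε)
    (hn : 48 / ε ^ 3 + 512 / ε ^ 6 < n) (hcard : ε * 2 ^ n ≤ (𝒜.card : ℝ)) :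
    ∃ X ∈ 𝒜, ∃ S : Finset (Fin n), S.card = 5 ∧ 8 ≤ (𝒜.filter fun Y => Y \ S = X \ S).card := by
  have hsum : ∑ W ∈ 𝒜, Wᶜ.card + ∑ W ∈ 𝒜, W.card = 𝒜.card * n := by
    rw [← Finset.sum_add_distrib, Finset.sum_const_nat]
    intro W _
    rw [Finset.card_compl_add_card, Fintype.card_fin]
  rcases le_total (∑ W ∈ 𝒜, W.card) (∑ W ∈ 𝒜, Wᶜ.card) with h | h
  · exact exists_eight_le_card_of_sum_compl hε hn hcard (by omega)
  · let c : Finset (Fin n) ↪ Finset (Fin n) := ⟨compl, compl_injective⟩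
    have hsc : ∑ W ∈ 𝒜.map c, Wᶜ.card = ∑ W ∈ 𝒜, W.card := by
      rw [Finset.sum_map]
      exact Finset.sum_congr rfl fun W _ => congrArg _ (compl_compl W)
    obtain ⟨X, hX, S, hS, h8⟩ := exists_eight_le_card_of_sum_compl (𝒜 := 𝒜.map c) hε hn
      (by rwa [Finset.card_map]) (by rw [Finset.card_map, hsc]; omega)
    obtain ⟨W, hW, rfl⟩ := Finset.mem_map.1 hX
    refine ⟨W, hW, S, hS, h8.trans ?_⟩
    rw [Finset.filter_map, Finset.card_map]
    refine Finset.card_le_card fun Y hY => ?_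
    rw [Finset.mem_filter] at hY ⊢
    refine ⟨hY.1, ?_⟩
    have h2 : Yᶜ \ S = Wᶜ \ S := hY.2
    rw [Finset.ext_iff] at h2 ⊢
    intro i
    have := h2 i
    simp only [Finset.mem_sdiff, Finset.mem_compl] at this ⊢
    tauto

end Triangles

theorem eight_le_of_hasDenseErasureCodes {L : ℕ} (h : HasDenseErasureCodes 5 L) : 8 ≤ L := by
  obtain ⟨ε, hε, hC⟩ := h
  obtain ⟨n, hn⟩ := exists_nat_gt (48 / ε ^ 3 + 512 / ε ^ 6)
  obtain ⟨C, hcode, hcard⟩ := hC n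
  rw [isErasureCode_iff_map] at hcode
  obtain ⟨X, hX, S, hS, h8⟩ := exists_eight_le_card
    (𝒜 := C.map (wordEquivFinset n).toEmbedding) hε hn (by rwa [Finset.card_map])
  exact h8.trans (hcode X hX S hS)

theorem theorem1p3 :
    erasureListSize 5 = 8 ∧ erasureListSize 6 ≤ 16 ∧ erasureListSize 7 ≤ 28 ∧
    ∃ c : ℝ, Tendsto basisRatio atTop (𝓝 c) ∧ |c - 0.29| < 0.005 ∧
      ∃ δ : ℕ → ℝ, Tendsto δ atTop (𝓝 0) ∧
        ∀ᶠ d : ℕ in atTop,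
          (erasureListSize d : ℝ) ≤ (c + δ d) * (d.choose (d / 2) : ℝ) := by
  refine ⟨le_antisymm ?_ ?_, ?_, ?_, ?_⟩
  · exact_mod_cast erasureListSize_le_of_indepCountBound fun k hk => indepCountBound_five hk
  · exact eight_le_of_hasDenseErasureCodes (erasureListSize_isLeast 5).1
  · exact_mod_cast erasureListSize_le_of_indepCountBound fun k hk => indepCountBound_six hk
  · exact_mod_cast erasureListSize_le_of_indepCountBound fun k hk => indepCountBound_seven hk
  · obtain ⟨c, hlim, hc⟩ := exists_tendsto_basisRatio
    obtain ⟨δ, hδ, hle⟩ := exists_tendsto_zero_erasureListSize_le hlim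
      (by linarith [(abs_lt.1 hc).1])
    exact ⟨c, hlim, hc, δ, hδ, Eventually.of_forall hle⟩
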